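/- Consider a dynamic matching market in which hard-to-match ($H$) and easy-to-match ($E$) agents arrive according to independent Poisson processes with rates $\lambda_H>0$ and $\lambda_E>0$. Each agent arrives with one item. An agent of type $T\in\{H,E\}$ finds the item of any other agent compatible with probability $p_T$, independently over all ordered pairs of agents, and leaves when she receives a compatible item. Under the policy ChainMatch($d$) there are always exactly $d$ bridge (or altruistic) agents, each of whom has an item left to give. When an agent arrives who finds no bridge agent's item compatible, she joins the waiting agents. Otherwise one of the bridge agents whose item she finds compatible, chosen uniformly at random, gives her its item, and a chain-segment starts with her. The chain-segment is extended by local search: if some waiting agents who are not yet in the chain-segment find the item of its last agent compatible, one of them receives this item and becomes the last agent; she is chosen uniformly at random among the $H$ agents of this kind if there are any, and among the $E$ agents of this kind otherwise. This is repeated as long as possible and takes no time. All agents of the chain-segment stop waiting, and its last agent becomes a bridge agent in place of the one that started it. The numbers $(H_t,E_t)$ of waiting $H$ and $E$ agents form a continuous-time Markov chain. Let $w_H$ be the average waiting time of $H$ agents in steady state, that is, the expected time between the arrival and the matching of an $H$ agent who arrives when $(H_t,E_t)$ has its stationary distribution (the waiting time is $0$ if she is matched on arrival). Let $p_E=1$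 and let $d\ge 1$ be a constant integer (independent of $p_H$). For every $p_H\in(0,1)$ the chain $(H_t,E_t)$ has a unique stationary distribution and $w_H<\infty$, and $$\lim_{p_H\to 0^+} p_H\, w_H=\frac{\ln\left(\frac{\lambda_H}{\lambda_E}+1\right)}{\lambda_H}.$$ In particular this limit does not depend on $d$. Consequently the limit is strictly decreasing in $\lambda_E$ for each fixed $\lambda_H$, and strictly decreasing in $\lambda_H$ for each fixed $\lambda_E$. -/

import Mathlib

open Filter Topology

noncomputable section

namespace ChainMatching

/-- The two types of agents: hard-to-match and easy-to-match. -/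
inductive AgentType
  | H
  | E

/-- The parameters of a market run under ChainMatch(`d`): the Poisson arrival rates `lamH`, `lamE`
of the two types, the probabilities `pH`, `pE` with which an agent of type `H`, `E` finds any given
item compatible, and the number `d` of altruistic/bridge agents present at any time. -/
structure Market where
  lamH : ℝ
  lamE : ℝ
  pH : unitInterval
  pE : unitInterval
  d : ℕ

/-- A pool of waiting agents: the labels of the waiting `H` agents and of the waiting `E` agents. -/
abbrev Pool : Type := Finset ℕ × Finset ℕ

/-- A state `(h, e)` of the market: the numbers of waiting `H` agents and `E` agents. -/
abbrev State : Type := ℕ × ℕ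

/-- The numbers of waiting agents in a pool. -/
def Pool.counts (P : Pool) : State := (P.1.card, P.2.card)

theorem sum_edge_weights (p : unitInterval) (A : Finset ℕ) :
    ∑ S ∈ A.powerset, (if S ⊆ A then
      ENNReal.ofReal (p : ℝ) ^ S.card * ENNReal.ofReal (1 - (p : ℝ)) ^ (A.card - S.card)
      else 0) = 1 := by
  rw [Finset.sum_congr rfl (fun S hS => if_pos (Finset.mem_powerset.mp hS)),
    Finset.sum_pow_mul_eq_add_pow,
    ← ENNReal.ofReal_add p.2.1 (by linarith [p.2.2])]
  simp

/-- The random subset of `A` that contains each element of `A` independently with probability `p`.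
It is used for the set of all agents in `A` who find a given item compatible, and for the set of all
agents in `A` whose item a given agent finds compatible. -/
def edges (p : unitInterval) (A : Finset ℕ) : PMF (Finset ℕ) :=
  PMF.ofFinset
    (fun S => if S ⊆ A then
      ENNReal.ofReal (p : ℝ) ^ S.card * ENNReal.ofReal (1 - (p : ℝ)) ^ (A.card - S.card)
      else 0)
    A.powerset (sum_edge_weights p A)
    (fun _ hS => if_neg (fun h => hS (Finset.mem_powerset.mpr h)))

namespace Market

variable (M : Market)

/-- The local search that extends a chain-segment, run for at most `n` steps from the pool `P` of
waiting agents who are not yet in the chain-segment; the result is the pool that is left over.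
In each step the edges from the last agent of the chain-segment to the agents of the pool are
revealed (each such edge is examined at most once, so it may be sampled when it is examined).
If there is an edge to an `H` agent, one of these `H` agents, chosen uniformly at random, is matched
and becomes the last agent; otherwise, if there is an edge to an `E` agent, one of these `E` agents,
chosen uniformly at random, is; otherwise the chain-segment ends. -/
def search : ℕ → Pool → PMF Pool
  | 0, P => PMF.pure P
  | n + 1, P =>
    (edges M.pH P.1).bind fun SH =>
    (edges M.pE P.2).bind fun SE =>
      if hH : SH.Nonempty then
        (PMF.uniformOfFinset SH hH).bind fun i => search n (P.1.erase i, P.2)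
      else if hE : SE.Nonempty then
        (PMF.uniformOfFinset SE hE).bind fun i => search n (P.1, P.2.erase i)
      else PMF.pure P

/-- The probability that an agent of type `T` finds a given item compatible. -/
def p : AgentType → unitInterval
  | .H => M.pH
  | .E => M.pE

/-- The arrival rate of agents of type `T`. -/
def lam : AgentType → ℝ
  | .H => M.lamH
  | .E => M.lamE

/-- The pool in which the waiting agents of each type are labelled `0, 1, 2, …`. -/
def pool (x : State) : Pool := (Finset.range x.1, Finset.range x.2)

/-- The state after an agent of type `T` has joined. -/
def join : AgentType → State → State
  | .H, x => (x.1 + 1, x.2)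
  | .E, x => (x.1, x.2 + 1)

/-- The random pool after the arrival of an agent of type `T` in state `x`. If no item of the `d`
bridge agents is compatible for her, she joins the pool. Otherwise she is matched and starts
a chain-segment, which is extended by local search as long as possible (every step removes an agent,
so there are at most `x.1 + x.2` steps). Everyone in the chain-segment leaves the pool;
its last agent replaces the bridge agent that started it. No bridge agent ever has an edge to
a waiting agent, so it does not matter which one starts the chain-segment. -/
def arrive (T : AgentType) (x : State) : PMF Pool :=
  (edges (M.p T) (Finset.range M.d)).bind fun B =>
    if B.Nonempty then M.search (x.1 + x.2) (pool x) else PMF.pure (pool (join T x))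

/-- The rate at which the Markov chain `(H_t, E_t)` jumps from `x` to `y ≠ x`. -/
def rate (x y : State) : ENNReal :=
  ENNReal.ofReal M.lamH * (M.arrive .H x).map Pool.counts y +
    ENNReal.ofReal M.lamE * (M.arrive .E x).map Pool.counts y

/-- `π` is a steady-state distribution of the continuous-time Markov chain `(H_t, E_t)` (whose jump
rates are bounded by `lamH + lamE`): it satisfies the balance equations `π Q = 0`. -/
def IsSteadyState (π : PMF State) : Prop :=
  ∀ y : State,
    ∑' x : {x : State // x ≠ y}, π x * M.rate x y = π y * ∑' z : {z : State // z ≠ y}, M.rate y z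

/-- The probability that an arriving agent is of type `T`. -/
def typeProb (T : AgentType) : ENNReal := ENNReal.ofReal (M.lam T / (M.lamH + M.lamE))

/-- The probability that a tagged waiting `H` agent is still waiting after the next `n` arrivals,
when the current state (which counts the tagged agent) is `x`. Agents are relabelled after every
arrival in such a way that the tagged agent always carries the label `0`. -/
def stillWaiting : ℕ → State → ENNReal
  | 0, _ => 1
  | n + 1, x =>
    M.typeProb .H *
      (∑' P : Pool, M.arrive .H x P * if 0 ∈ P.1 then stillWaiting n (Pool.counts P) else 0) +
    M.typeProb .E *
      (∑' P : Pool, M.arrive .E x P * if 0 ∈ P.1 then stillWaiting n (Pool.counts P) else 0)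

/-- The probability that the tagged `H` agent is still waiting at time `t`, when the state (which
counts her) is `x` at time `0`: the number of arrivals up to time `t` is Poisson distributed with
mean `(lamH + lamE) * t`. -/
def waitingTail (x : State) (t : ℝ) : ENNReal :=
  ∑' n : ℕ, ENNReal.ofReal (Real.exp (-((M.lamH + M.lamE) * t)) *
    ((M.lamH + M.lamE) * t) ^ n / (n.factorial : ℝ)) * M.stillWaiting n x

/-- The expected remaining waiting time `𝐄[W] = ∫₀^∞ 𝐏[W > t] dt` of a waiting `H` agent when the
state (which counts her) is `x`. -/
def meanRemainingWait (x : State) : ENNReal := ∫⁻ t in Set.Ioi (0 : ℝ), M.waitingTail x t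

/-- The expected waiting time of an `H` agent who arrives when the state is distributed according
to `π`. She waits for time `0` if she is matched by a bridge agent on arrival, and joins
the pool otherwise. -/
def meanWaitH (π : PMF State) : ENNReal :=
  ∑' x : State, π x * (edges M.pH (Finset.range M.d) ∅ * M.meanRemainingWait (join .H x))

open Classical in
/-- The steady-state distribution (an arbitrary value if there is none). -/
def steadyState : PMF State :=
  if h : ∃ π : PMF State, M.IsSteadyState π then h.choose else PMF.pure (0, 0)

/-- The average waiting time `w_H` of `H` agents in steady-state, with values in `[0, ∞]`. -/
def wH : ENNReal := M.meanWaitH M.steadyState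

end Market

end ChainMatching

end

noncomputable section

namespace ChainMatching

/-! Since `E` agents accept every item and there is at least one bridge agent, an arriving `E` agent
always starts a chain-segment, and no segment can end while an `E` agent waits. Stationarity
therefore puts no mass on states with waiting `E` agents, and only the number `h` of waiting `H`
agents matters. With `q = 1 - pH`, each arrival adds one `H` agent with probability `a = lamH /
(lamH + lamE) * q ^ d` (`joinProb`). Otherwise a segment sweeps downward from `h`, passing a level
`j` with probability `1 - q ^ j` and stopping there with probability `q ^ j`.

For this chain the balance equations collapse to the two-term recursion `π (k + 1) * (1 - q ^ (k +
1)) = a * π k` (`steady_recursion`), which yields existence and uniqueness. Little's law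
(`tsum_stillWaiting`, `lamH_mul_meanWaitH`) turns `lamH * wH` into the mean of `π`.

The recursion says that the generating function satisfies `φ (q z) = (1 - a z) φ z`. Its logarithmic
derivative telescopes along `z = q ^ n`, so that the mean is `∑ a q ^ i / (1 - a q ^ i)`
(`mean_eq_sum_add`). Times `1 - q = pH`, this is a Riemann sum of `∫ dx / (1 - x)` over `[0, a]`,
hence within `pH * a / (1 - a)` of `-log (1 - a)` (`mean_bounds`). As `pH → 0`, `a → lamH / (lamH +
lamE)`; the factor `q ^ d`, the only trace of `d`, tends to `1`. -/

/-- The expectation of an `ENNReal`-valued function. -/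
def expect {α : Type*} (μ : PMF α) (f : α → ENNReal) : ENNReal := ∑' a, μ a * f a

/-! ### Expectations under a `PMF` -/

section Expect

variable {α β : Type*}

theorem expect_pure (a : α) (f : α → ENNReal) : expect (PMF.pure a) f = f a := by
  classical
  unfold expect
  rw [tsum_eq_single a]
  · simp
  · intro b hb
    simp [PMF.pure_apply, hb]

theorem expect_bind (μ : PMF α) (κ : α → PMF β) (f : β → ENNReal) :
    expect (μ.bind κ) f = expect μ fun a => expect (κ a) f := by
  unfold expect
  simp_rw [PMF.bind_apply, ← ENNReal.tsum_mul_right, ← ENNReal.tsum_mul_left]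
  rw [ENNReal.tsum_comm]
  simp_rw [mul_assoc]

theorem expect_map (μ : PMF α) (g : α → β) (f : β → ENNReal) :
    expect (μ.map g) f = expect μ fun a => f (g a) := by
  rw [PMF.map, expect_bind]
  simp [expect_pure]

theorem expect_const (μ : PMF α) (c : ENNReal) : expect μ (fun _ => c) = c := by
  simp [expect, ENNReal.tsum_mul_right, μ.tsum_coe]

theorem expect_congr {μ : PMF α} {f g : α → ENNReal} (h : ∀ a ∈ μ.support, f a = g a) :
    expect μ f = expect μ g := by
  refine tsum_congr fun a => ?_
  by_cases ha : a ∈ μ.support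
  · rw [h a ha]
  · rw [(PMF.apply_eq_zero_iff μ a).2 ha, zero_mul, zero_mul]

theorem expect_indicator [DecidableEq α] (μ : PMF α) (a : α) :
    expect μ (fun x => if x = a then 1 else 0) = μ a := by
  unfold expect
  rw [tsum_eq_single a] <;> simp +contextual

theorem expect_uniformOfFinset (S : Finset α) (hS : S.Nonempty) (f : α → ENNReal) :
    expect (PMF.uniformOfFinset S hS) f = (S.card : ENNReal)⁻¹ * ∑ i ∈ S, f i := by
  classical
  unfold expect
  rw [tsum_eq_sum (s := S), Finset.mul_sum]
  · exact Finset.sum_congr rfl fun i hi => by rw [PMF.uniformOfFinset_apply_of_mem hS hi]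
  · intro i hi
    rw [PMF.uniformOfFinset_apply_of_notMem hS hi, zero_mul]

end Expect

/-! ### One step of local search: random edges and a uniform choice -/

/-- The probability of having no edge to a given agent. -/
def noEdge (p : unitInterval) : ENNReal := ENNReal.ofReal (1 - (p : ℝ))

theorem expect_edges (p : unitInterval) (A : Finset ℕ) (f : Finset ℕ → ENNReal) :
    expect (edges p A) f = ∑ S ∈ A.powerset,
      ENNReal.ofReal (p : ℝ) ^ S.card * noEdge p ^ (A.card - S.card) * f S := by
  unfold expect
  rw [tsum_eq_sum (s := A.powerset)]
  · refine Finset.sum_congr rfl fun S hS => ?_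
    rw [edges, PMF.ofFinset_apply, if_pos (Finset.mem_powerset.1 hS), noEdge]
  · intro S hS
    rw [edges, PMF.ofFinset_apply, if_neg fun h => hS (Finset.mem_powerset.2 h), zero_mul]

theorem edges_empty (p : unitInterval) (A : Finset ℕ) : edges p A ∅ = noEdge p ^ A.card := by
  rw [edges, PMF.ofFinset_apply, if_pos (Finset.empty_subset A)]
  simp [noEdge]

theorem expect_edges_one (A : Finset ℕ) (f : Finset ℕ → ENNReal) :
    expect (edges 1 A) f = f A := by
  rw [expect_edges, Finset.sum_eq_single A]
  · simp
  · intro S hS hne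
    have : S.card < A.card :=
      Finset.card_lt_card (Finset.ssubset_iff_subset_ne.2 ⟨Finset.mem_powerset.1 hS, hne⟩)
    simp [noEdge, Nat.sub_ne_zero_of_lt this]
  · simp

/-- The probability that a given agent among `n` is the one chosen by a step of local search. -/
def pickProb (p : unitInterval) (n : ℕ) : ENNReal :=
  ∑ m ∈ Finset.range n, ((n - 1).choose m : ENNReal) *
    (ENNReal.ofReal (p : ℝ) ^ (m + 1) * noEdge p ^ (n - (m + 1)) * ((m + 1 : ℕ) : ENNReal)⁻¹)

/-- Subsets of `A` containing `i` correspond to subsets of `A.erase i`, grouped here by cardinality.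
-/
theorem sum_powerset_mem (A : Finset ℕ) (i : ℕ) (hi : i ∈ A) (F : ℕ → ENNReal) :
    ∑ S ∈ A.powerset, (if i ∈ S then F S.card else 0) =
      ∑ m ∈ Finset.range A.card, ((A.card - 1).choose m : ENNReal) * F (m + 1) := by
  have hA : A = insert i (A.erase i) := (Finset.insert_erase hi).symm
  have hc : (A.erase i).card + 1 = A.card := Finset.card_erase_add_one hi
  conv_lhs => rw [hA]
  rw [Finset.sum_powerset_insert (Finset.notMem_erase i A)]
  have h1 : ∀ S ∈ (A.erase i).powerset, i ∉ S := fun S hS h =>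
    Finset.notMem_erase i A (Finset.mem_powerset.1 hS h)
  rw [Finset.sum_eq_zero fun S hS => if_neg (h1 S hS), zero_add,
    Finset.sum_congr rfl fun S hS => show _ = F (S.card + 1) by
      rw [if_pos (Finset.mem_insert_self i S), Finset.card_insert_of_notMem (h1 S hS)],
    Finset.sum_powerset_apply_card (fun m => F (m + 1)), hc, ← hc, Nat.add_sub_cancel]
  simp [nsmul_eq_mul]

/-- Exchanging the sums over edge sets and over chosen agents leaves a coefficient of `G i` that
does not depend on `i`: by symmetry every agent is equally likely to be picked. -/
theorem expect_edges_pick (p : unitInterval) (A : Finset ℕ) (G : ℕ → ENNReal) (c : ENNReal) :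
    expect (edges p A) (fun S =>
      if h : S.Nonempty then expect (PMF.uniformOfFinset S h) G else c) =
      pickProb p A.card * ∑ i ∈ A, G i + noEdge p ^ A.card * c := by
  set w : ℕ → ENNReal := fun m => ENNReal.ofReal (p : ℝ) ^ m * noEdge p ^ (A.card - m)
  have key : ∀ S ∈ A.powerset, w S.card *
      (if h : S.Nonempty then expect (PMF.uniformOfFinset S h) G else c) =
      (∑ i ∈ A, (if i ∈ S then w S.card * (S.card : ENNReal)⁻¹ else 0) * G i) +
        if S = ∅ then noEdge p ^ A.card * c else 0 := by
    intro S hS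
    rcases S.eq_empty_or_nonempty with rfl | h
    · simp [w]
    · rw [dif_pos h, if_neg h.ne_empty, expect_uniformOfFinset, add_zero, ← mul_assoc,
        Finset.mul_sum]
      simp only [ite_mul, zero_mul]
      rw [← Finset.sum_filter, Finset.filter_mem_eq_inter,
        Finset.inter_eq_right.2 (Finset.mem_powerset.1 hS)]
  rw [expect_edges, Finset.sum_congr rfl key, Finset.sum_add_distrib, Finset.sum_comm,
    Finset.mul_sum]
  congr 1
  · refine Finset.sum_congr rfl fun i hi => ?_
    rw [← Finset.sum_mul,
      sum_powerset_mem A i hi (fun m => w m * (m : ENNReal)⁻¹)]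
    rfl
  · simp

/-- Total probability, from the case of constant functions. It makes any closed form of `pickProb`
unnecessary. -/
theorem pickProb_mul_add (p : unitInterval) (n : ℕ) :
    pickProb p n * n + noEdge p ^ n = 1 := by
  have h := expect_edges_pick p (Finset.range n) (fun _ => 1) 1
  simp only [expect_const, dite_eq_ite, ite_self] at h
  simpa using h.symm

theorem noEdge_le_one (p : unitInterval) : noEdge p ≤ 1 := by
  rw [noEdge, ENNReal.ofReal_le_one]
  linarith [p.2.1]

theorem noEdge_pow_ne_top (p : unitInterval) (n : ℕ) : noEdge p ^ n ≠ ⊤ :=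
  ENNReal.pow_ne_top ENNReal.ofReal_ne_top

theorem pickProb_mul (p : unitInterval) (n : ℕ) :
    pickProb p n * n = 1 - noEdge p ^ n :=
  ENNReal.eq_sub_of_add_eq (noEdge_pow_ne_top p n) (pickProb_mul_add p n)

/-! ### Local search among `H` agents only -/

/-- The expectation of `g k`, where `k` is the number of `H` agents that are left over by a local
search from `h` waiting `H` agents, each of whom is missed with probability `Q`. -/
def searchExpect (Q : ENNReal) (g : ℕ → ENNReal) : ℕ → ENNReal
  | 0 => g 0
  | h + 1 => (1 - Q ^ (h + 1)) * searchExpect Q g h + Q ^ (h + 1) * g (h + 1)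

theorem expect_edges_ite (p : unitInterval) (n : ℕ) (a b : ENNReal) :
    expect (edges p (Finset.range n)) (fun S => if S.Nonempty then a else b) =
      (1 - noEdge p ^ n) * a + noEdge p ^ n * b := by
  have h := expect_edges_pick p (Finset.range n) (fun _ => a) b
  simp only [expect_const, dite_eq_ite] at h
  rw [h, ← pickProb_mul]
  simp [mul_assoc]

namespace Market

variable (M : Market)

theorem expect_search_succ (n : ℕ) (A : Finset ℕ) (f : Pool → ENNReal) :
    expect (M.search (n + 1) (A, ∅)) f =
      pickProb M.pH A.card * ∑ i ∈ A, expect (M.search n (A.erase i, ∅)) f +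
        noEdge M.pH ^ A.card * f (A, ∅) := by
  rw [← expect_edges_pick]
  rw [search, expect_bind]
  congr 1
  ext SH
  rw [expect_bind, expect_edges]
  simp only [Finset.powerset_empty, Finset.sum_singleton, Finset.card_empty, pow_zero, one_mul,
    Finset.not_nonempty_empty, dite_false, le_refl, tsub_eq_zero_of_le]
  split_ifs with h
  · rw [expect_bind]
  · rw [expect_pure]

/-- The pool sizes do not depend on who is picked: all `A.card` summands agree, and `pickProb` times
their number is `1 - noEdge ^ A.card`. -/
theorem expect_search_counts (g : State → ENNReal) (n : ℕ) (A : Finset ℕ) (hA : A.card ≤ n) :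
    expect (M.search n (A, ∅)) (fun P => g P.counts) =
      searchExpect (noEdge M.pH) (fun k => g (k, 0)) A.card := by
  induction n generalizing A with
  | zero =>
    obtain rfl : A = ∅ := Finset.card_eq_zero.1 (Nat.le_zero.1 hA)
    rw [search, expect_pure]
    rfl
  | succ n ih =>
    rw [expect_search_succ]
    rcases A.eq_empty_or_nonempty with rfl | hne
    · simp [searchExpect, Pool.counts]
    · obtain ⟨m, hm⟩ : ∃ m, A.card = m + 1 := ⟨A.card - 1, by have := hne.card_pos; omega⟩
      have hc : ∀ i ∈ A, (A.erase i).card = m := fun i hi => by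
        rw [Finset.card_erase_of_mem hi, hm, Nat.add_sub_cancel]
      rw [Finset.sum_congr rfl fun i hi => by rw [ih (A.erase i) (by rw [hc i hi]; omega), hc i hi]]
      rw [Finset.sum_const, nsmul_eq_mul, ← mul_assoc, pickProb_mul, hm, searchExpect]
      simp [Pool.counts, hm]

theorem expect_search_not_mem (g : State → ENNReal) (n : ℕ) (A : Finset ℕ) (a : ℕ) (ha : a ∉ A) :
    expect (M.search n (A, ∅)) (fun P => if a ∈ P.1 then g P.counts else 0) = 0 := by
  induction n generalizing A with
  | zero => simp [search, expect_pure, ha]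
  | succ n ih =>
    rw [expect_search_succ, Finset.sum_eq_zero fun i _ =>
      ih (A.erase i) fun h => ha (Finset.mem_of_mem_erase h)]
    simp [ha]

/-- A tagged waiting `H` agent is left over by local search as often as any other one. -/
theorem card_mul_expect_search_mem (g : State → ENNReal) (n : ℕ) (A : Finset ℕ) (hA : A.card ≤ n)
    (a : ℕ) (ha : a ∈ A) :
    A.card * expect (M.search n (A, ∅)) (fun P => if a ∈ P.1 then g P.counts else 0) =
      searchExpect (noEdge M.pH) (fun k => k * g (k, 0)) A.card := by
  induction n generalizing A with
  | zero =>
    rw [Finset.card_eq_zero.1 (Nat.le_zero.1 hA)] at ha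
    simp at ha
  | succ n ih =>
    obtain ⟨m, hm⟩ : ∃ m, A.card = m + 1 :=
      ⟨A.card - 1, by have := Finset.card_pos.2 ⟨a, ha⟩; omega⟩
    have hc : ∀ i ∈ A, (A.erase i).card = m := fun i hi => by
      rw [Finset.card_erase_of_mem hi, hm, Nat.add_sub_cancel]
    have hs : ∑ i ∈ A, expect (M.search n (A.erase i, ∅))
        (fun P => if a ∈ P.1 then g P.counts else 0) =
        searchExpect (noEdge M.pH) (fun k => k * g (k, 0)) m := by
      -- If `a` herself is picked, she is gone. The other `m` choices leave her in a pool of size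
      -- `m`, and each contributes `1 / m` of the same value by induction.
      rw [← Finset.add_sum_erase A _ ha, expect_search_not_mem _ _ _ _ _ (Finset.notMem_erase a A),
        zero_add]
      rcases Nat.eq_zero_or_pos m with rfl | hpos
      · rw [Finset.card_eq_zero.1 (hc a ha)]
        simp [searchExpect]
      · have hm0 : (m : ENNReal) ≠ 0 := by exact_mod_cast hpos.ne'
        rw [Finset.sum_congr rfl fun i hi => show _ =
            (m : ENNReal)⁻¹ * searchExpect (noEdge M.pH) (fun k => k * g (k, 0)) m by
          have hi' := Finset.mem_erase.1 hi
          have h := ih (A.erase i) (by rw [hc i hi'.2]; omega)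
            (Finset.mem_erase.2 ⟨fun h => hi'.1 h.symm, ha⟩)
          rw [hc i hi'.2] at h
          rw [← h, ← mul_assoc, ENNReal.inv_mul_cancel hm0 (ENNReal.natCast_ne_top m), one_mul]]
        rw [Finset.sum_const, hc a ha, nsmul_eq_mul, ← mul_assoc,
          ENNReal.mul_inv_cancel hm0 (ENNReal.natCast_ne_top m), one_mul]
    rw [expect_search_succ, hs, mul_add, ← mul_assoc, mul_comm (A.card : ENNReal), pickProb_mul,
      hm, searchExpect]
    simp only [ha, if_true, Pool.counts, hm, Finset.card_empty]
    ring

/-- If `E` agents accept every item, then local search leaves no `E` agent over. -/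
theorem search_support_snd (hE : M.pE = 1) (n : ℕ) (P : Pool) (hP : P.1.card + P.2.card ≤ n) :
    ∀ P' ∈ (M.search n P).support, P'.2 = ∅ := by
  induction n generalizing P with
  | zero =>
    intro P' h
    rw [search, PMF.support_pure, Set.mem_singleton_iff] at h
    rw [h]
    exact Finset.card_eq_zero.1 (by omega)
  | succ n ih =>
    intro P' h
    rw [search, PMF.mem_support_bind_iff] at h
    obtain ⟨SH, hSH, h⟩ := h
    rw [PMF.mem_support_bind_iff] at h
    obtain ⟨SE, hSE, h⟩ := h
    have hSH' : SH ⊆ P.1 := by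
      by_contra hn
      exact (PMF.mem_support_iff _ _).1 hSH (by rw [edges, PMF.ofFinset_apply, if_neg hn])
    -- With `pE = 1` the edge set is almost surely all of `P.2`, so the search can stop only when
    -- `P.2` is empty.
    have hSE' : SE = P.2 := by
      by_contra hn
      refine (PMF.mem_support_iff _ _).1 hSE ?_
      have := expect_edges_one P.2 (fun S => if S = SE then 1 else 0)
      rw [expect_indicator, if_neg (Ne.symm hn)] at this
      rw [hE, this]
    split_ifs at h with h1 h2
    · rw [PMF.mem_support_bind_iff] at h
      obtain ⟨i, hi, h⟩ := h
      have hi' := hSH' ((PMF.mem_support_uniformOfFinset_iff h1 i).1 hi)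
      refine ih _ ?_ P' h
      have := Finset.card_erase_add_one hi'
      simp only
      omega
    · rw [PMF.mem_support_bind_iff] at h
      obtain ⟨i, hi, h⟩ := h
      have hi' := (PMF.mem_support_uniformOfFinset_iff h2 i).1 hi
      rw [hSE'] at hi'
      refine ih _ ?_ P' h
      have := Finset.card_erase_add_one hi'
      simp only
      omega
    · rw [PMF.support_pure, Set.mem_singleton_iff] at h
      rw [h, ← hSE', ← Finset.not_nonempty_iff_eq_empty]
      exact h2

end Market

end ChainMatching

/-! ### The chain observed at arrivals and its balance equations -/

namespace ChainMatching

namespace Market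

variable (M : Market)

/-- The parameters of the theorem: positive arrival rates, at least one bridge agent, `E` agents
who accept every item, and `H` agents who are neither of this kind nor accept nothing. -/
structure IsRegular : Prop where
  lamH_pos : 0 < M.lamH
  lamE_pos : 0 < M.lamE
  one_le_d : 1 ≤ M.d
  pE_eq : M.pE = 1
  pH_pos : 0 < (M.pH : ℝ)
  pH_lt : (M.pH : ℝ) < 1

/-- The probability that an item is incompatible for an `H` agent. -/
def q : ENNReal := noEdge M.pH

/-- The probability that an arriving agent joins the pool (as an `H` agent). -/
def joinProb : ENNReal := M.typeProb .H * M.q ^ M.d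

/-- The probability that an arriving agent starts a chain-segment. -/
def startProb : ENNReal := M.typeProb .H * (1 - M.q ^ M.d) + M.typeProb .E

/-- The transition probabilities at arrivals. -/
def jump (x y : State) : ENNReal :=
  M.typeProb .H * (M.arrive .H x).map Pool.counts y +
    M.typeProb .E * (M.arrive .E x).map Pool.counts y

theorem tsum_jump_mul (x : State) (g : State → ENNReal) :
    ∑' y, M.jump x y * g y =
      M.typeProb .H * expect (M.arrive .H x) (fun P => g P.counts) +
        M.typeProb .E * expect (M.arrive .E x) (fun P => g P.counts) := by
  rw [← expect_map _ Pool.counts g, ← expect_map _ Pool.counts g]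
  simp only [jump, expect, add_mul, mul_assoc]
  rw [ENNReal.tsum_add, ENNReal.tsum_mul_left, ENNReal.tsum_mul_left]

theorem expect_arrive_H (x : State) (f : Pool → ENNReal) :
    expect (M.arrive .H x) f =
      (1 - M.q ^ M.d) * expect (M.search (x.1 + x.2) (pool x)) f +
        M.q ^ M.d * f (pool (join .H x)) := by
  rw [arrive, expect_bind, q, ← expect_edges_ite]
  congr 1
  ext S
  split_ifs
  · rfl
  · rw [expect_pure]

variable {M}

theorem q_ne_top : M.q ≠ ⊤ := ENNReal.ofReal_ne_top

theorem q_pow_le_one (n : ℕ) : M.q ^ n ≤ 1 := pow_le_one₀ zero_le (noEdge_le_one M.pH)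

namespace IsRegular

theorem q_toReal (hM : M.IsRegular) : M.q.toReal = 1 - (M.pH : ℝ) :=
  ENNReal.toReal_ofReal (by linarith [hM.pH_lt])

theorem q_lt_one (hM : M.IsRegular) : M.q < 1 := by
  rw [q, noEdge, ENNReal.ofReal_lt_one]
  linarith [hM.pH_pos]

theorem q_ne_zero (hM : M.IsRegular) : M.q ≠ 0 := by
  rw [q, noEdge, Ne, ENNReal.ofReal_eq_zero]
  linarith [hM.pH_lt]

theorem lam_pos (hM : M.IsRegular) : 0 < M.lamH + M.lamE := add_pos hM.lamH_pos hM.lamE_pos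

theorem typeProb_add (hM : M.IsRegular) : M.typeProb .H + M.typeProb .E = 1 := by
  have := hM.lam_pos
  have h1 := hM.lamH_pos
  have h2 := hM.lamE_pos
  simp only [typeProb, lam]
  rw [← ENNReal.ofReal_add (by positivity) (by positivity), ← add_div, div_self this.ne',
    ENNReal.ofReal_one]

theorem lam_mul_typeProb (hM : M.IsRegular) (T : AgentType) :
    ENNReal.ofReal (M.lamH + M.lamE) * M.typeProb T = ENNReal.ofReal (M.lam T) := by
  rw [typeProb, ← ENNReal.ofReal_mul hM.lam_pos.le, mul_div_cancel₀ _ hM.lam_pos.ne']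

theorem joinProb_add (hM : M.IsRegular) : M.joinProb + M.startProb = 1 := by
  rw [joinProb, startProb, ← add_assoc, ← mul_add, add_tsub_cancel_of_le (q_pow_le_one _), mul_one,
    hM.typeProb_add]

theorem joinProb_toReal (hM : M.IsRegular) :
    M.joinProb.toReal = M.lamH / (M.lamH + M.lamE) * (1 - (M.pH : ℝ)) ^ M.d := by
  have := hM.lam_pos
  have h1 := hM.lamH_pos
  rw [joinProb, ENNReal.toReal_mul, ENNReal.toReal_pow, hM.q_toReal, typeProb,
    ENNReal.toReal_ofReal (by simp only [lam]; positivity)]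
  rfl

theorem joinProb_lt_one (hM : M.IsRegular) : M.joinProb < 1 := by
  calc M.joinProb ≤ M.typeProb .H * 1 := by unfold joinProb; gcongr; exact q_pow_le_one _
    _ < 1 := by
      rw [mul_one, typeProb, ENNReal.ofReal_lt_one, div_lt_one hM.lam_pos]
      simp only [lam]
      linarith [hM.lamE_pos]

theorem joinProb_ne_zero (hM : M.IsRegular) : M.joinProb ≠ 0 := by
  refine mul_ne_zero ?_ (pow_ne_zero _ hM.q_ne_zero)
  rw [typeProb, Ne, ENNReal.ofReal_eq_zero, not_le]
  exact div_pos hM.lamH_pos hM.lam_pos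

theorem startProb_eq (hM : M.IsRegular) : M.startProb = 1 - M.joinProb :=
  ENNReal.eq_sub_of_add_eq hM.joinProb_lt_one.ne_top (by rw [add_comm, hM.joinProb_add])

theorem expect_arrive_E (hM : M.IsRegular) (x : State) (f : Pool → ENNReal) :
    expect (M.arrive .E x) f = expect (M.search (x.1 + x.2) (pool x)) f := by
  have h : M.p .E = 1 := hM.pE_eq
  rw [arrive, expect_bind, h, expect_edges_one, if_pos]
  simpa using Nat.one_le_iff_ne_zero.1 hM.one_le_d

theorem tsum_jump_eq (hM : M.IsRegular) (x : State) (g : State → ENNReal) :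
    ∑' y, M.jump x y * g y = M.joinProb * g (join .H x) +
      M.startProb * expect (M.search (x.1 + x.2) (pool x)) (fun P => g P.counts) := by
  rw [tsum_jump_mul, hM.expect_arrive_E, expect_arrive_H, joinProb, startProb]
  simp only [pool, Pool.counts, Finset.card_range]
  ring

theorem tsum_jump_zero (hM : M.IsRegular) (h : ℕ) (g : State → ENNReal) :
    ∑' y, M.jump (h, 0) y * g y = M.joinProb * g (h + 1, 0) +
      M.startProb * searchExpect M.q (fun k => g (k, 0)) h := by
  rw [hM.tsum_jump_eq]
  simp only [pool, Finset.range_zero, add_zero, join]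
  rw [M.expect_search_counts g h _ (by simp), Finset.card_range, q]

/-- A search leaves no `E` agent over, so waiting `E` agents survive an arrival only if the newcomer
joins, and she is then of type `H`. -/
theorem tsum_jump_E (hM : M.IsRegular) (x : State) :
    ∑' y : State, M.jump x y * (if y.2 = 0 then 0 else 1) =
      M.joinProb * (if x.2 = 0 then 0 else 1) := by
  rw [hM.tsum_jump_eq, expect_congr (g := fun _ => 0), expect_const, mul_zero, add_zero]
  · rfl
  · intro P hP
    rw [Pool.counts, search_support_snd M hM.pE_eq _ _ (by simp [pool]) P hP]
    simp

theorem rate_eq (hM : M.IsRegular) (x y : State) :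
    M.rate x y = ENNReal.ofReal (M.lamH + M.lamE) * M.jump x y := by
  rw [rate, jump, mul_add, ← mul_assoc, ← mul_assoc, hM.lam_mul_typeProb, hM.lam_mul_typeProb]
  rfl

theorem tsum_jump (hM : M.IsRegular) (x : State) : ∑' y, M.jump x y = 1 := by
  have h := hM.tsum_jump_eq x fun _ => 1
  simpa only [mul_one, expect_const, hM.joinProb_add] using h

theorem jump_le_one (hM : M.IsRegular) (x y : State) : M.jump x y ≤ 1 :=
  (ENNReal.le_tsum y).trans (hM.tsum_jump x).le

theorem tsum_ne_add (f : State → ENNReal) (y : State) :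
    ∑' x : {x : State // x ≠ y}, f x + f y = ∑' x, f x := by
  rw [← Summable.tsum_add_tsum_compl (s := {y}) ENNReal.summable ENNReal.summable, tsum_singleton,
    add_comm]
  rfl

/-- All states share the total arrival rate `lamH + lamE`, which cancels. Adding the finite
self-loop term `π y * M.jump y y` to both sides turns rate balance into invariance under the jump
kernel. -/
theorem isSteadyState_iff (hM : M.IsRegular) (π : PMF State) :
    M.IsSteadyState π ↔ ∀ y, ∑' x, π x * M.jump x y = π y := by
  have hΛ : ENNReal.ofReal (M.lamH + M.lamE) ≠ 0 := by
    rw [Ne, ENNReal.ofReal_eq_zero, not_le]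
    exact hM.lam_pos
  refine forall_congr' fun y => ?_
  simp_rw [hM.rate_eq, mul_left_comm (π _), ENNReal.tsum_mul_left, mul_left_comm (π _)]
  rw [ENNReal.mul_right_inj hΛ ENNReal.ofReal_ne_top]
  have hfin : π y * M.jump y y ≠ ⊤ :=
    ENNReal.mul_ne_top (π.apply_ne_top y) (ne_top_of_le_ne_top ENNReal.one_ne_top (hM.jump_le_one y y))
  rw [← ENNReal.add_left_inj hfin, tsum_ne_add (fun x => π x * M.jump x y), ← mul_add,
    tsum_ne_add (M.jump y), hM.tsum_jump, mul_one]

theorem tsum_steady (hM : M.IsRegular) {π : PMF State} (hπ : M.IsSteadyState π)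
    (g : State → ENNReal) :
    ∑' x, π x * ∑' y, M.jump x y * g y = ∑' y, π y * g y := by
  simp_rw [← ENNReal.tsum_mul_left]
  rw [ENNReal.tsum_comm]
  refine tsum_congr fun y => ?_
  rw [← (hM.isSteadyState_iff π).1 hπ y, ← ENNReal.tsum_mul_right]
  simp_rw [mul_assoc]

theorem steady_E_eq_zero (hM : M.IsRegular) {π : PMF State} (hπ : M.IsSteadyState π)
    (x : State) (hx : x.2 ≠ 0) : π x = 0 := by
  have h := hM.tsum_steady hπ fun y => if y.2 = 0 then 0 else 1
  simp_rw [hM.tsum_jump_E, mul_left_comm (π _), ENNReal.tsum_mul_left] at h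
  set m := ∑' x : State, π x * (if x.2 = 0 then 0 else 1) with hm
  have hle : m ≤ 1 := by
    rw [← π.tsum_coe, hm]
    refine ENNReal.tsum_le_tsum fun x => ?_
    split_ifs <;> simp
  -- The mass `m` of states with waiting `E` agents satisfies `joinProb * m = m` with `m` finite and
  -- `joinProb < 1`.
  have h0 : m = 0 := by
    by_contra h0
    have := ENNReal.mul_lt_mul_left h0 (ne_top_of_le_ne_top ENNReal.one_ne_top hle)
      hM.joinProb_lt_one
    rw [h, one_mul] at this
    exact this.ne rfl
  have := ENNReal.tsum_eq_zero.1 h0 x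
  simpa [hx] using this

theorem tsum_steady_eq (hM : M.IsRegular) {π : PMF State} (hπ : M.IsSteadyState π)
    (g : State → ENNReal) : ∑' x, π x * g x = ∑' h : ℕ, π (h, 0) * g (h, 0) := by
  rw [ENNReal.tsum_prod (f := fun h e => π (h, e) * g (h, e))]
  refine tsum_congr fun h => tsum_eq_single 0 fun e he => ?_
  rw [hM.steady_E_eq_zero hπ (h, e) he, zero_mul]

/-- The balance equations in terms of the number of waiting `H` agents. -/
theorem tsum_steady_H (hM : M.IsRegular) {π : PMF State} (hπ : M.IsSteadyState π)
    (g : ℕ → ENNReal) :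
    ∑' h, π (h, 0) * (M.joinProb * g (h + 1) + M.startProb * searchExpect M.q g h) =
      ∑' h, π (h, 0) * g h := by
  have h := hM.tsum_steady hπ fun y => g y.1
  rw [hM.tsum_steady_eq hπ, hM.tsum_steady_eq hπ] at h
  simpa only [hM.tsum_jump_zero] using h

end IsRegular

end Market
end ChainMatching

/-! ### The stationary distribution -/

namespace ChainMatching

/-- The probability that local search from `h` waiting `H` agents leaves `k` of them over. -/
def searchProb (Q : ENNReal) (k h : ℕ) : ENNReal :=
  searchExpect Q (fun j => if j = k then 1 else 0) h

theorem searchProb_zero (Q : ENNReal) (k : ℕ) : searchProb Q k 0 = if 0 = k then 1 else 0 := rfl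

theorem searchProb_succ (Q : ENNReal) (k h : ℕ) :
    searchProb Q k (h + 1) = (1 - Q ^ (h + 1)) * searchProb Q k h +
      Q ^ (h + 1) * if h + 1 = k then 1 else 0 := rfl

/-- For `h ≥ k` the search ends at `k` with probability `Q ^ k * ∏ (1 - Q ^ j)` over `k < j ≤ h`.
Comparing `k` with `k + 1` changes one factor of the product; the last term accounts for `h = k`. -/
theorem mul_searchProb (Q : ENNReal) (k h : ℕ) :
    Q * searchProb Q k h = (1 - Q ^ (k + 1)) * searchProb Q (k + 1) h +
      Q ^ (k + 1) * if h = k then 1 else 0 := by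
  induction h with
  | zero =>
    rcases k with _ | k <;> simp [searchProb_zero]
  | succ h ih =>
    rw [searchProb_succ, mul_add, mul_left_comm, ih, searchProb_succ]
    by_cases h1 : h = k
    · subst h1
      simp
    · by_cases h2 : h + 1 = k
      · subst h2
        simp
        ring
      · simp [h1, h2]
        ring

theorem searchExpect_zero (Q : ENNReal) (h : ℕ) : searchExpect Q (fun _ => 0) h = 0 := by
  induction h with
  | zero => rfl
  | succ h ih => simp [searchExpect, ih]

theorem searchExpect_one {Q : ENNReal} (hQ : Q ≤ 1) (h : ℕ) :
    searchExpect Q (fun _ => 1) h = 1 := by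
  induction h with
  | zero => rfl
  | succ h ih => rw [searchExpect, ih, mul_one, mul_one, tsub_add_cancel_of_le (pow_le_one₀ zero_le hQ)]

theorem searchExpect_mono (Q : ENNReal) {f g : ℕ → ENNReal} (hfg : f ≤ g) (h : ℕ) :
    searchExpect Q f h ≤ searchExpect Q g h := by
  induction h with
  | zero => exact hfg 0
  | succ h ih =>
    rw [searchExpect, searchExpect]
    gcongr
    exact hfg _

theorem searchProb_le_one {Q : ENNReal} (hQ : Q ≤ 1) (k h : ℕ) : searchProb Q k h ≤ 1 := by
  rw [← searchExpect_one hQ h]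
  refine searchExpect_mono Q (fun j => ?_) h
  simp only
  split_ifs <;> simp

/-- The unnormalised steady-state probability of `k` waiting `H` agents. -/
def weight (Q a : ENNReal) : ℕ → ENNReal
  | 0 => 1
  | k + 1 => a * weight Q a k / (1 - Q ^ (k + 1))

section Weight

variable {Q a : ENNReal}

theorem one_sub_pow_ne_zero (hQ : Q < 1) (k : ℕ) : 1 - Q ^ (k + 1) ≠ 0 :=
  (tsub_pos_of_lt (pow_lt_one₀ zero_le hQ k.succ_ne_zero)).ne'

theorem one_sub_pow_ne_top (k : ℕ) : 1 - Q ^ k ≠ ⊤ :=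
  ne_top_of_le_ne_top ENNReal.one_ne_top tsub_le_self

theorem weight_succ_mul (hQ : Q < 1) (k : ℕ) :
    weight Q a (k + 1) * (1 - Q ^ (k + 1)) = a * weight Q a k :=
  ENNReal.div_mul_cancel (one_sub_pow_ne_zero hQ k) (one_sub_pow_ne_top _)

theorem eq_mul_weight (hQ : Q < 1) {f : ℕ → ENNReal}
    (hf : ∀ k, f (k + 1) * (1 - Q ^ (k + 1)) = a * f k) (k : ℕ) : f k = f 0 * weight Q a k := by
  induction k with
  | zero => simp [weight]
  | succ k ih =>
    rw [← ENNReal.mul_left_inj (one_sub_pow_ne_zero hQ k) (one_sub_pow_ne_top (Q := Q) (k + 1)),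
      mul_assoc, weight_succ_mul hQ, hf, ih]
    ring

theorem weight_ne_top (hQ : Q < 1) (ha : a < 1) (k : ℕ) : weight Q a k ≠ ⊤ := by
  induction k with
  | zero => exact ENNReal.one_ne_top
  | succ k ih =>
    exact ENNReal.div_ne_top (ENNReal.mul_ne_top ha.ne_top ih) (one_sub_pow_ne_zero hQ k)

/-- Sequences that satisfy the recursion of the steady state decay geometrically. -/
theorem summable_of_recursion {q a : ℝ} (hq0 : 0 ≤ q) (hq : q < 1) (ha0 : 0 < a) (ha : a < 1)
    {v : ℕ → ℝ} (h0 : 0 < v 0) (hv : ∀ k, v (k + 1) * (1 - q ^ (k + 1)) = a * v k) :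
    (∀ k, 0 < v k) ∧ Summable fun k : ℕ => ((k : ℝ) + 1) * v k := by
  have hpos : ∀ k, 0 < 1 - q ^ (k + 1) := fun k =>
    sub_pos.2 (pow_lt_one₀ hq0 hq k.succ_ne_zero)
  have hs : ∀ k, v (k + 1) = a * v k / (1 - q ^ (k + 1)) := fun k => by
    rw [eq_div_iff (hpos k).ne', hv]
  have hvpos : ∀ k, 0 < v k := by
    intro k
    induction k with
    | zero => exact h0
    | succ k ih =>
      rw [hs]
      exact div_pos (mul_pos ha0 ih) (hpos k)
  -- The ratio of consecutive terms tends to `a`. The factor `k + 1` secures a finite mean along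
  -- with finite total mass.
  refine ⟨hvpos, summable_of_ratio_test_tendsto_lt_one ha
    (Eventually.of_forall fun k => (mul_pos (by positivity) (hvpos k)).ne') ?_⟩
  have hlim : Tendsto (fun k : ℕ => (1 + 1 / ((k : ℝ) + 1)) * (a / (1 - q ^ (k + 1)))) atTop
      (𝓝 ((1 + 0) * (a / (1 - 0)))) := by
    refine Tendsto.mul (tendsto_const_nhds.add tendsto_one_div_add_atTop_nhds_zero_nat)
      (tendsto_const_nhds.div (tendsto_const_nhds.sub ?_) (by norm_num))
    exact (tendsto_pow_atTop_nhds_zero_of_lt_one hq0 hq).comp (tendsto_add_atTop_nat 1)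
  simp only [add_zero, sub_zero, div_one, one_mul] at hlim
  refine hlim.congr fun k => ?_
  have h1 := hvpos k
  have h2 := hpos k
  rw [Real.norm_of_nonneg (mul_pos (by positivity) (hvpos _)).le,
    Real.norm_of_nonneg (mul_pos (by positivity) (hvpos _)).le, hs]
  push_cast
  field_simp

theorem toReal_one_sub_pow (hQ : Q < 1) (k : ℕ) :
    (1 - Q ^ k).toReal = 1 - Q.toReal ^ k := by
  rw [ENNReal.toReal_sub_of_le (pow_le_one₀ zero_le hQ.le) ENNReal.one_ne_top, ENNReal.toReal_one,
    ENNReal.toReal_pow]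

theorem tsum_weight_ne_top (hQ : Q < 1) (ha : a < 1) (ha0 : a ≠ 0) : ∑' k, weight Q a k ≠ ⊤ := by
  have h := summable_of_recursion (v := fun k => (weight Q a k).toReal) (q := Q.toReal)
    (a := a.toReal) ENNReal.toReal_nonneg
    (by simpa using (ENNReal.toReal_lt_toReal hQ.ne_top ENNReal.one_ne_top).2 hQ)
    (ENNReal.toReal_pos ha0 ha.ne_top)
    (by simpa using (ENNReal.toReal_lt_toReal ha.ne_top ENNReal.one_ne_top).2 ha)
    (by simp [weight]) fun k => by
      rw [← toReal_one_sub_pow hQ, ← ENNReal.toReal_mul, weight_succ_mul hQ, ENNReal.toReal_mul]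
  have hs : Summable fun k => (weight Q a k).toReal := by
    refine h.2.of_nonneg_of_le (fun k => ENNReal.toReal_nonneg) fun k => ?_
    exact le_mul_of_one_le_left ENNReal.toReal_nonneg (by simp)
  have := hs.tsum_ofReal_ne_top
  simpa only [ENNReal.ofReal_toReal (weight_ne_top hQ ha _)] using this

theorem searchProb_of_lt (k h : ℕ) (hk : h < k) : searchProb Q k h = 0 := by
  induction h with
  | zero => simp [searchProb_zero, hk.ne]
  | succ h ih => simp [searchProb_succ, ih (by omega), hk.ne]

theorem searchProb_self (k : ℕ) : searchProb Q k k = Q ^ k := by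
  rcases k with _ | k
  · simp [searchProb_zero]
  · simp [searchProb_succ, searchProb_of_lt (Q := Q) (k + 1) k (by omega)]

/-- The factors `1 - Q ^ i` of the search probability cancel the denominators of the weight, leaving
a geometric sequence in `j`. -/
theorem weight_mul_searchProb_add (hQ : Q < 1) (k j : ℕ) :
    weight Q a (k + j) * searchProb Q k (k + j) = Q ^ k * weight Q a k * a ^ j := by
  induction j with
  | zero => simp [searchProb_self, mul_comm]
  | succ j ih =>
    rw [← add_assoc, searchProb_succ, if_neg (by omega), mul_zero, add_zero, ← mul_assoc,
      weight_succ_mul hQ, mul_assoc, ih]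
    ring

theorem tsum_weight_mul_searchProb (hQ : Q < 1) (k : ℕ) :
    ∑' h, weight Q a h * searchProb Q k h = Q ^ k * weight Q a k * (1 - a)⁻¹ := by
  rw [← Summable.sum_add_tsum_nat_add' (k := k) ENNReal.summable,
    Finset.sum_eq_zero fun h hh => by
      rw [searchProb_of_lt k h (Finset.mem_range.1 hh), mul_zero], zero_add]
  simp_rw [add_comm _ k, weight_mul_searchProb_add hQ]
  rw [ENNReal.tsum_mul_left, ENNReal.tsum_geometric]

end Weight

namespace Market

variable {M : Market}

namespace IsRegular

theorem jump_zero_eq (hM : M.IsRegular) (h k : ℕ) :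
    M.jump (h, 0) (k, 0) = M.joinProb * (if h + 1 = k then 1 else 0) +
      M.startProb * searchProb M.q k h := by
  have := hM.tsum_jump_zero h fun y => if y = (k, 0) then 1 else 0
  rw [tsum_eq_single (k, 0) (by simp +contextual)] at this
  simpa [searchProb] using this

theorem jump_zero_eq_zero (hM : M.IsRegular) (h k e : ℕ) (he : e ≠ 0) :
    M.jump (h, 0) (k, e) = 0 := by
  have := hM.tsum_jump_zero h fun y => if y = (k, e) then 1 else 0
  rw [tsum_eq_single (k, e) (by simp +contextual)] at this
  simpa [he.symm, searchExpect_zero] using this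

theorem startProb_ne_zero (hM : M.IsRegular) : M.startProb ≠ 0 := by
  rw [hM.startProb_eq]
  exact (tsub_pos_of_lt hM.joinProb_lt_one).ne'

theorem startProb_ne_top (hM : M.IsRegular) : M.startProb ≠ ⊤ := by
  rw [hM.startProb_eq]
  exact ne_top_of_le_ne_top ENNReal.one_ne_top tsub_le_self

/-- Of the inflow into `k`, joining supplies the fraction `1 - q ^ k` of the weight and searching
the fraction `q ^ k`, since `startProb = 1 - joinProb` cancels the geometric sum. -/
theorem tsum_weight_mul_jump (hM : M.IsRegular) (k : ℕ) :
    ∑' h, weight M.q M.joinProb h * M.jump (h, 0) (k, 0) = weight M.q M.joinProb k := by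
  simp_rw [hM.jump_zero_eq, mul_add, mul_left_comm (weight _ _ _)]
  rw [ENNReal.tsum_add, ENNReal.tsum_mul_left, ENNReal.tsum_mul_left,
    tsum_weight_mul_searchProb hM.q_lt_one, ← hM.startProb_eq, mul_left_comm,
    ENNReal.mul_inv_cancel hM.startProb_ne_zero hM.startProb_ne_top, mul_one]
  have h1 : M.joinProb * ∑' h, weight M.q M.joinProb h * (if h + 1 = k then 1 else 0) =
      (1 - M.q ^ k) * weight M.q M.joinProb k := by
    rcases k with _ | k
    · simp
    · rw [tsum_eq_single k (by simp +contextual), if_pos rfl, mul_one,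
        ← weight_succ_mul hM.q_lt_one, mul_comm]
  rw [h1, ← add_mul, tsub_add_cancel_of_le (q_pow_le_one k), one_mul]

/-- Let `R k` be the stationary probability that a search would end at `k`. Balance expresses `π k`
through `π (k - 1)` and `R k`, while `mul_searchProb` links `R k` to `R (k + 1)`; eliminating `R`
inductively leaves the recursion. The elimination needs subtraction and is done in `ℝ`. -/
theorem steady_recursion (hM : M.IsRegular) {π : PMF State} (hπ : M.IsSteadyState π) (k : ℕ) :
    π (k + 1, 0) * (1 - M.q ^ (k + 1)) = M.joinProb * π (k, 0) := by
  have hfin : ∀ k, ∑' h, π (h, 0) * searchProb M.q k h ≠ ⊤ := by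
    refine fun k => ne_top_of_le_ne_top ENNReal.one_ne_top ?_
    calc ∑' h, π (h, 0) * searchProb M.q k h ≤ ∑' h, π (h, 0) * 1 := by
          gcongr
          exact searchProb_le_one hM.q_lt_one.le _ _
      _ ≤ 1 := by
          rw [← hM.tsum_steady_eq hπ fun _ => 1]
          simp [π.tsum_coe]
  have hbal : ∀ k, M.joinProb * (∑' h, π (h, 0) * if h + 1 = k then 1 else 0) +
      M.startProb * ∑' h, π (h, 0) * searchProb M.q k h = π (k, 0) := by
    intro k
    have h := hM.tsum_steady_H hπ fun j => if j = k then 1 else 0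
    rw [tsum_eq_single (f := fun h => π (h, 0) * if h = k then 1 else 0) k
      (by simp +contextual), if_pos rfl, mul_one] at h
    rw [← h, ← ENNReal.tsum_mul_left, ← ENNReal.tsum_mul_left, ← ENNReal.tsum_add]
    refine tsum_congr fun j => ?_
    rw [mul_add, searchProb]
    ring
  have hrec : ∀ k, M.q * ∑' h, π (h, 0) * searchProb M.q k h =
      (1 - M.q ^ (k + 1)) * ∑' h, π (h, 0) * searchProb M.q (k + 1) h +
        M.q ^ (k + 1) * π (k, 0) := by
    intro k
    rw [← ENNReal.tsum_mul_left]
    simp_rw [mul_left_comm M.q, mul_searchProb, mul_add]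
    rw [ENNReal.tsum_add]
    simp_rw [mul_left_comm (π _)]
    rw [ENNReal.tsum_mul_left, ENNReal.tsum_mul_left, tsum_eq_single (f := fun h => π (h, 0) * if h = k then 1 else 0) k
      (by simp +contextual), if_pos rfl, mul_one]
  set R : ℕ → ENNReal := fun k => ∑' h, π (h, 0) * searchProb M.q k h with hR
  have hbal0 : M.startProb.toReal * (R 0).toReal = (π (0, 0)).toReal := by
    rw [← hbal 0, ← ENNReal.toReal_mul]
    simp [hR]
  have ht : ∀ (k : ℕ), M.joinProb * π (k, 0) ≠ ⊤ := fun k =>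
    ENNReal.mul_ne_top hM.joinProb_lt_one.ne_top (π.apply_ne_top _)
  have hbalS : ∀ k, M.joinProb.toReal * (π (k, 0)).toReal + M.startProb.toReal * (R (k + 1)).toReal =
      (π (k + 1, 0)).toReal := by
    intro k
    rw [← hbal (k + 1), tsum_eq_single k (by simp +contextual), if_pos rfl, mul_one,
      ENNReal.toReal_add (ht k) (ENNReal.mul_ne_top hM.startProb_ne_top (hfin _)),
      ENNReal.toReal_mul, ENNReal.toReal_mul]
  have hrecR : ∀ k, M.q.toReal * (R k).toReal = (1 - M.q.toReal ^ (k + 1)) * (R (k + 1)).toReal +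
      M.q.toReal ^ (k + 1) * (π (k, 0)).toReal := by
    intro k
    have := congrArg ENNReal.toReal (hrec k)
    rwa [ENNReal.toReal_add (ENNReal.mul_ne_top (one_sub_pow_ne_top _) (hfin _))
      (ENNReal.mul_ne_top (ENNReal.pow_ne_top q_ne_top) (π.apply_ne_top _)), ENNReal.toReal_mul,
      ENNReal.toReal_mul, ENNReal.toReal_mul, toReal_one_sub_pow hM.q_lt_one,
      ENNReal.toReal_pow] at this
  have hab : M.startProb.toReal = 1 - M.joinProb.toReal := by
    rw [hM.startProb_eq, ENNReal.toReal_sub_of_le hM.joinProb_lt_one.le ENNReal.one_ne_top,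
      ENNReal.toReal_one]
  rw [hab] at hbal0 hbalS
  have main : ∀ k, (π (k + 1, 0)).toReal * (1 - M.q.toReal ^ (k + 1)) =
      M.joinProb.toReal * (π (k, 0)).toReal := by
    intro k
    induction k with
    | zero =>
      have h1 := hbalS 0
      have h2 := hrecR 0
      simp only [zero_add, pow_one] at *
      linear_combination (M.q.toReal) * hbal0 + (-(1 - M.q.toReal)) * h1 + (-(1 - M.joinProb.toReal)) * h2
    | succ k ih =>
      linear_combination (M.q.toReal) * hbalS k - (1 - M.q.toReal ^ (k + 2)) * hbalS (k + 1)
        - (1 - M.joinProb.toReal) * hrecR (k + 1) + M.q.toReal * ih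
  rw [← ENNReal.toReal_eq_toReal_iff' (ENNReal.mul_ne_top (π.apply_ne_top _)
    (one_sub_pow_ne_top _)) (ht k), ENNReal.toReal_mul, ENNReal.toReal_mul,
    toReal_one_sub_pow hM.q_lt_one]
  exact main k

theorem existsUnique_steadyState (hM : M.IsRegular) : ∃! π : PMF State, M.IsSteadyState π := by
  have hZ0 : ∑' k, weight M.q M.joinProb k ≠ 0 := fun h =>
    one_ne_zero (ENNReal.tsum_eq_zero.1 h 0)
  have hZ := tsum_weight_ne_top hM.q_lt_one hM.joinProb_lt_one hM.joinProb_ne_zero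
  set Z := ∑' k, weight M.q M.joinProb k with hZdef
  let ν : PMF ℕ := PMF.normalize (weight M.q M.joinProb) hZ0 hZ
  refine ⟨ν.map fun k => (k, 0), (hM.isSteadyState_iff _).2 ?_, ?_⟩
  · rintro ⟨k, e⟩
    have h1 := expect_map ν (fun k => ((k, 0) : State)) (fun x => M.jump x (k, e))
    rw [expect] at h1
    rw [h1, ← expect_indicator (ν.map _) (k, e), expect_map]
    rcases eq_or_ne e 0 with rfl | he
    · have h2 : ∀ j, ((j, 0) : State) = (k, 0) ↔ j = k := by simp
      simp_rw [h2, expect_indicator]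
      simp only [expect, ν, PMF.normalize_apply]
      rw [← hZdef, tsum_congr fun h => mul_right_comm _ _ _, ENNReal.tsum_mul_right, hM.tsum_weight_mul_jump]
    · have h2 : ∀ j, ((j, 0) : State) = (k, e) ↔ False := by simp [he.symm]
      simp_rw [hM.jump_zero_eq_zero _ k e he, h2]
      simp
  · intro π hπ
    have hw := eq_mul_weight (f := fun k => π (k, 0)) hM.q_lt_one (hM.steady_recursion hπ)
    have hsum : π (0, 0) * Z = 1 := by
      rw [← π.tsum_coe, hZdef, ← ENNReal.tsum_mul_left]
      have := hM.tsum_steady_eq hπ fun _ => 1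
      simp only [mul_one] at this
      rw [this]
      exact tsum_congr fun k => (hw k).symm
    have h0 : π (0, 0) = Z⁻¹ := ENNReal.eq_inv_of_mul_eq_one_left hsum
    ext ⟨k, e⟩
    rw [← expect_indicator (ν.map _) (k, e), expect_map]
    rcases eq_or_ne e 0 with rfl | he
    · have h2 : ∀ j, ((j, 0) : State) = (k, 0) ↔ j = k := by simp
      simp_rw [h2, expect_indicator]
      refine (hw k).trans ?_
      rw [h0, mul_comm]
      rfl
    · have h2 : ∀ j, ((j, 0) : State) = (k, e) ↔ False := by simp [he.symm]
      simp_rw [h2, if_false, expect_const]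
      exact hM.steady_E_eq_zero hπ (k, e) he

end IsRegular
end Market
end ChainMatching

/-! ### Little's law -/

namespace ChainMatching

open MeasureTheory

namespace Market

variable {M : Market}

theorem stillWaiting_succ (n : ℕ) (x : State) :
    M.stillWaiting (n + 1) x =
      M.typeProb .H * expect (M.arrive .H x)
        (fun P => if 0 ∈ P.1 then M.stillWaiting n P.counts else 0) +
      M.typeProb .E * expect (M.arrive .E x)
        (fun P => if 0 ∈ P.1 then M.stillWaiting n P.counts else 0) := rfl

namespace IsRegular

theorem stillWaiting_le_one (hM : M.IsRegular) (n : ℕ) (x : State) : M.stillWaiting n x ≤ 1 := by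
  induction n generalizing x with
  | zero => exact le_rfl
  | succ n ih =>
    have key : ∀ μ : PMF Pool,
        expect μ (fun P => if 0 ∈ P.1 then M.stillWaiting n P.counts else 0) ≤ 1 := by
      intro μ
      rw [← expect_const μ 1]
      unfold expect
      gcongr
      simp only
      split_ifs
      · exact ih _
      · exact zero_le
    rw [stillWaiting_succ, ← hM.typeProb_add]
    exact add_le_add (mul_le_of_le_one_right zero_le (key _)) (mul_le_of_le_one_right zero_le (key _))

/-- Both sides are the expected number of agents in the pool just after one arrival who are still
waiting `n` arrivals later. The left side splits them into old agents and the newcomer; the right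
side conditions on the new pool size. Exchangeability lets one tagged agent stand for all. -/
theorem mul_stillWaiting_succ (hM : M.IsRegular) (n h : ℕ) :
    h * M.stillWaiting (n + 1) (h, 0) + M.joinProb * M.stillWaiting n (h + 1, 0) =
      M.joinProb * ((h + 1 : ℕ) * M.stillWaiting n (h + 1, 0)) +
        M.startProb * searchExpect M.q (fun k => k * M.stillWaiting n (k, 0)) h := by
  rcases h with _ | h
  · simp [searchExpect]
  · have hs := M.card_mul_expect_search_mem (M.stillWaiting n) (h + 1) (Finset.range (h + 1))
      (by simp) 0 (by simp)
    rw [Finset.card_range] at hs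
    change _ = searchExpect M.q _ _ at hs
    rw [stillWaiting_succ, hM.expect_arrive_E, expect_arrive_H, ← hs, joinProb, startProb]
    simp only [pool, join, Pool.counts, Finset.card_range, Finset.range_zero, Finset.card_empty,
      add_zero, Finset.mem_range, Nat.succ_pos, if_true]
    push_cast
    ring

/-- Little's law, with time counted in arrivals. -/
theorem tsum_stillWaiting (hM : M.IsRegular) {π : PMF State} (hπ : M.IsSteadyState π)
    (hpos : ∀ h : ℕ, π (h, 0) ≠ 0) (hm : ∑' h : ℕ, π (h, 0) * h ≠ ⊤) :
    M.joinProb * ∑' n, ∑' h : ℕ, π (h, 0) * M.stillWaiting n (h + 1, 0) =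
      ∑' h : ℕ, π (h, 0) * h := by
  set A : ℕ → ENNReal := fun n => ∑' h : ℕ, π (h, 0) * (h * M.stillWaiting n (h, 0)) with hA
  set c : ℕ → ENNReal := fun n => ∑' h : ℕ, π (h, 0) * M.stillWaiting n (h + 1, 0) with hc
  -- `A n` is the expected number of currently waiting agents who survive `n` more arrivals. By
  -- stationarity it may be evaluated one arrival later, where the newcomer accounts for `joinProb *
  -- c n`.
  have hstep : ∀ n, A (n + 1) + M.joinProb * c n = A n := by
    intro n
    have h := hM.tsum_steady_H hπ fun k => k * M.stillWaiting n (k, 0)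
    rw [hA, hc]
    simp only
    rw [← h, ← ENNReal.tsum_mul_left, ← ENNReal.tsum_add]
    refine tsum_congr fun k => ?_
    rw [← hM.mul_stillWaiting_succ]
    ring
  have hA0 : A 0 = ∑' h : ℕ, π (h, 0) * h := by simp [hA, stillWaiting]
  have hsum : ∀ N, A N + ∑ n ∈ Finset.range N, M.joinProb * c n = A 0 := by
    intro N
    induction N with
    | zero => simp
    | succ N ih => rw [Finset.sum_range_succ, ← ih, ← hstep N]; ring
  have hle : ∑' n, M.joinProb * c n ≤ A 0 := by
    rw [ENNReal.tsum_eq_iSup_nat]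
    exact iSup_le fun N => (hsum N).symm ▸ le_add_self
  have hfin : ∑' n, M.joinProb * c n ≠ ⊤ := ne_top_of_le_ne_top (hA0 ▸ hm) hle
  have hc0 : Tendsto (fun n => M.joinProb * c n) atTop (𝓝 0) :=
    ENNReal.tendsto_atTop_zero_of_tsum_ne_top hfin
  -- The telescoped series converges, so `c n → 0`; as every `π (h, 0)` is positive, each survival
  -- probability tends to `0`. Dominated convergence then gives `A n → 0`.
  have hs0 : ∀ h : ℕ, Tendsto (fun n => M.stillWaiting n (h + 1, 0)) atTop (𝓝 0) := by
    intro h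
    have hk : M.joinProb * π (h, 0) ≠ 0 := mul_ne_zero hM.joinProb_ne_zero (hpos h)
    have hkt : M.joinProb * π (h, 0) ≠ ⊤ :=
      ENNReal.mul_ne_top hM.joinProb_lt_one.ne_top (π.apply_ne_top _)
    have h1 : Tendsto (fun n => M.joinProb * π (h, 0) * M.stillWaiting n (h + 1, 0)) atTop (𝓝 0) := by
      refine tendsto_of_tendsto_of_tendsto_of_le_of_le tendsto_const_nhds hc0
        (fun n => zero_le) fun n => ?_
      simp only [hc]
      rw [mul_assoc]
      gcongr
      exact ENNReal.le_tsum (f := fun h : ℕ => π (h, 0) * M.stillWaiting n (h + 1, 0)) h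
    have h2 := ENNReal.Tendsto.const_mul (a := (M.joinProb * π (h, 0))⁻¹) h1
      (Or.inr (ENNReal.inv_ne_top.2 hk))
    simpa only [← mul_assoc, mul_zero, ENNReal.inv_mul_cancel hk hkt, one_mul] using h2
  have hAlim : Tendsto A atTop (𝓝 0) := by
    have h := tendsto_lintegral_of_dominated_convergence (μ := Measure.count)
      (F := fun n (h : ℕ) => π (h, 0) * (h * M.stillWaiting n (h, 0))) (f := fun _ => 0)
      (fun h : ℕ => π (h, 0) * h) (fun n => measurable_of_countable _)
      (fun n => Eventually.of_forall fun h => by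
        simp only
        gcongr
        exact mul_le_of_le_one_right zero_le (hM.stillWaiting_le_one n _))
      (by rwa [lintegral_count])
      (Eventually.of_forall fun h => by
        rcases h with _ | h
        · simp
        · have := ENNReal.Tendsto.const_mul (a := π (h + 1, 0) * (h + 1 : ℕ)) (hs0 h)
            (Or.inr (ENNReal.mul_ne_top (π.apply_ne_top _) (ENNReal.natCast_ne_top _)))
          simpa only [mul_zero, mul_assoc] using this)
    simpa only [lintegral_count, tsum_zero] using h
  have hlim : Tendsto (fun N => A N + ∑ n ∈ Finset.range N, M.joinProb * c n) atTop
      (𝓝 (0 + ∑' n, M.joinProb * c n)) :=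
    hAlim.add ENNReal.summable.hasSum.tendsto_sum_nat
  simp_rw [hsum] at hlim
  rw [← ENNReal.tsum_mul_left, ← hA0]
  simpa using (tendsto_nhds_unique hlim tendsto_const_nhds)

/-- Up to the factor `r`, the integrand is the Gamma density of shape `n + 1`: each arrival count
persists for mean time `1 / r`. -/
theorem lintegral_poisson {r : ℝ} (hr : 0 < r) (n : ℕ) :
    ∫⁻ t in Set.Ioi (0 : ℝ), ENNReal.ofReal (Real.exp (-(r * t)) * (r * t) ^ n / (n.factorial : ℝ)) =
      (ENNReal.ofReal r)⁻¹ := by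
  have h1 := ProbabilityTheory.lintegral_gammaPDF_eq_one (a := (n : ℝ) + 1) (r := r) (by positivity) hr
  have hr0 : ENNReal.ofReal r ≠ 0 := by simpa using hr
  rw [← lintegral_add_compl _ (measurableSet_Ioi (a := (0 : ℝ)))] at h1
  have h2 : ∫⁻ x in (Set.Ioi (0 : ℝ))ᶜ, ProbabilityTheory.gammaPDF ((n : ℝ) + 1) r x = 0 := by
    rw [Set.compl_Ioi, setLIntegral_congr Iio_ae_eq_Iic.symm]
    exact ProbabilityTheory.lintegral_gammaPDF_of_nonpos le_rfl
  rw [h2, add_zero, setLIntegral_congr_fun (g := fun t => ENNReal.ofReal r *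
    ENNReal.ofReal (Real.exp (-(r * t)) * (r * t) ^ n / (n.factorial : ℝ))) measurableSet_Ioi,
    lintegral_const_mul _ (by fun_prop)] at h1
  · exact ENNReal.eq_inv_of_mul_eq_one_left (by rw [mul_comm]; exact h1)
  · intro t ht
    have ht : 0 < t := ht
    simp only
    rw [ProbabilityTheory.gammaPDF_of_nonneg ht.le, ← ENNReal.ofReal_mul hr.le,
      Real.Gamma_nat_eq_factorial, add_sub_cancel_right, Real.rpow_natCast, mul_pow,
      Real.rpow_add_one hr.ne', Real.rpow_natCast]
    congr 1
    ring

theorem meanRemainingWait_eq (hM : M.IsRegular) (x : State) :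
    M.meanRemainingWait x =
      (ENNReal.ofReal (M.lamH + M.lamE))⁻¹ * ∑' n, M.stillWaiting n x := by
  unfold meanRemainingWait waitingTail
  rw [lintegral_tsum fun n => by fun_prop]
  rw [← ENNReal.tsum_mul_left]
  refine tsum_congr fun n => ?_
  rw [lintegral_mul_const _ (by fun_prop), lintegral_poisson hM.lam_pos]

theorem lamH_mul_meanWaitH (hM : M.IsRegular) {π : PMF State} (hπ : M.IsSteadyState π)
    (hpos : ∀ h : ℕ, π (h, 0) ≠ 0) (hm : ∑' h : ℕ, π (h, 0) * h ≠ ⊤) :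
    ENNReal.ofReal M.lamH * M.meanWaitH π = ∑' h : ℕ, π (h, 0) * h := by
  have hΛ : ENNReal.ofReal (M.lamH + M.lamE) ≠ 0 := by simpa using hM.lam_pos
  have hH : ENNReal.ofReal M.lamH = ENNReal.ofReal (M.lamH + M.lamE) * M.typeProb .H :=
    (hM.lam_mul_typeProb .H).symm
  rw [← hM.tsum_stillWaiting hπ hpos hm, meanWaitH, hM.tsum_steady_eq hπ, hH, ENNReal.tsum_comm]
  simp_rw [edges_empty, Finset.card_range, hM.meanRemainingWait_eq, join, ENNReal.tsum_mul_left,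
    mul_left_comm (π _)]
  rw [ENNReal.tsum_mul_left, ENNReal.tsum_mul_left, joinProb, q]
  calc _ = (ENNReal.ofReal (M.lamH + M.lamE) * (ENNReal.ofReal (M.lamH + M.lamE))⁻¹) *
        (M.typeProb .H * noEdge M.pH ^ M.d *
          ∑' h : ℕ, π (h, 0) * ∑' n, M.stillWaiting n (h + 1, 0)) := by ring
    _ = _ := by rw [ENNReal.mul_inv_cancel hΛ ENNReal.ofReal_ne_top, one_mul]

end IsRegular
end Market
end ChainMatching

/-! ### The mean number of waiting agents -/

namespace ChainMatching

section Mean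

variable {q a : ℝ} {v : ℕ → ℝ}

/-- The mean of a distribution that satisfies the steady-state recursion, in terms of the moments
`∑ v k * q ^ (n k)` and `∑ k * v k * q ^ (n k)`. -/
theorem mean_eq_sum_add (hq0 : 0 < q) (hq : q < 1) (ha0 : 0 < a) (ha : a < 1) (h0 : 0 < v 0)
    (hv : ∀ k, v (k + 1) * (1 - q ^ (k + 1)) = a * v k) (hsum : ∑' k, v k = 1) :
    ∃ ψ : ℕ → ℝ, Tendsto ψ atTop (𝓝 0) ∧ (∀ n, 0 ≤ ψ n) ∧ ∀ n, ∑' k : ℕ, k * v k =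
      ∑ i ∈ Finset.range n, a * q ^ i / (1 - a * q ^ i) + ψ n := by
  obtain ⟨hpos, hs⟩ := summable_of_recursion hq0.le hq ha0 ha h0 hv
  have hz0 : ∀ n : ℕ, 0 < q ^ n := fun n => pow_pos hq0 n
  have hz1 : ∀ n : ℕ, q ^ n ≤ 1 := fun n => pow_le_one₀ hq0.le hq.le
  have hzk : ∀ n k : ℕ, (q ^ n) ^ k ≤ 1 := fun n k => pow_le_one₀ (hz0 n).le (hz1 n)
  have hsφ : ∀ n : ℕ, Summable fun k => v k * (q ^ n) ^ k := fun n => by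
    refine hs.of_nonneg_of_le (fun k => by have := hpos k; positivity) fun k => ?_
    calc v k * (q ^ n) ^ k ≤ v k * 1 := by gcongr; exacts [(hpos k).le, hzk n k]
      _ ≤ (k + 1) * v k := by nlinarith [hpos k, (Nat.cast_nonneg k : (0 : ℝ) ≤ k)]
  have hsN : ∀ n : ℕ, Summable fun k : ℕ => k * v k * (q ^ n) ^ k := fun n => by
    refine hs.of_nonneg_of_le (fun k => by have := hpos k; positivity) fun k => ?_
    calc k * v k * (q ^ n) ^ k ≤ k * v k * 1 := by
          have := hpos k
          gcongr
          exact hzk n k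
      _ ≤ (k + 1) * v k := by nlinarith [hpos k]
  set φ : ℕ → ℝ := fun n => ∑' k, v k * (q ^ n) ^ k with hφ
  set N : ℕ → ℝ := fun n => ∑' k : ℕ, k * v k * (q ^ n) ^ k with hN
  -- With `z = q ^ n`, the recursion for `v` identifies the coefficients of `φ (z) - φ (q z)` with
  -- those of `a z φ (z)`. The analogue for `N = z φ'` uses the same recursion times `k + 1`.
  have hφ_rec : ∀ n, φ n - φ (n + 1) = a * q ^ n * φ n := by
    intro n
    simp only [hφ]
    rw [← (hsφ n).tsum_sub (hsφ (n + 1)), ((hsφ n).sub (hsφ (n + 1))).tsum_eq_zero_add,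
      ← tsum_mul_left]
    simp only [pow_zero, sub_self, zero_add]
    refine tsum_congr fun k => ?_
    rw [pow_succ q n, mul_pow (q ^ n) q]
    linear_combination ((q ^ n) ^ (k + 1)) * hv k
  have hN_rec : ∀ n, N n - N (n + 1) = a * q ^ n * (N n + φ n) := by
    intro n
    simp only [hφ, hN]
    rw [← (hsN n).tsum_sub (hsN (n + 1)), ((hsN n).sub (hsN (n + 1))).tsum_eq_zero_add,
      ← (hsN n).tsum_add (hsφ n), ← tsum_mul_left]
    simp only [pow_zero, sub_self, zero_add]
    refine tsum_congr fun k => ?_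
    rw [pow_succ q n, mul_pow (q ^ n) q]
    push_cast
    linear_combination ((k + 1) * (q ^ n) ^ (k + 1)) * hv k
  have hφ_ge : ∀ n, v 0 ≤ φ n := fun n => by
    have := (hsφ n).le_tsum 0 fun k _ => by have := hpos k; positivity
    simpa using this
  have hφ_pos : ∀ n, 0 < φ n := fun n => h0.trans_le (hφ_ge n)
  have hN_nonneg : ∀ n, 0 ≤ N n := fun n => tsum_nonneg fun k => by
    have := hpos k
    positivity
  have hm : ∑' k : ℕ, k * v k = N 0 := by simp [hN]
  have hN_le : ∀ n, N n ≤ q ^ n * N 0 := by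
    intro n
    rw [hN, ← tsum_mul_left]
    refine (hsN n).tsum_le_tsum (fun k => ?_) ((hsN 0).mul_left _)
    rcases k with _ | k
    · simp
    · have h1 := hpos (k + 1)
      have h2 : (q ^ n) ^ (k + 1) ≤ q ^ n := by
        rw [pow_succ]
        exact mul_le_of_le_one_left (hz0 n).le (hzk n k)
      simp only [pow_zero, one_pow, mul_one]
      rw [mul_comm (q ^ n)]
      gcongr
  -- `N / φ` is `z` times the logarithmic derivative of `φ`; it drops by `a z / (1 - a z)` from `z`
  -- to `q z`, and starts at the mean because `φ 0 = 1`.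
  refine ⟨fun n => N n / φ n, ?_, fun n => div_nonneg (hN_nonneg n) (hφ_pos n).le, fun n => ?_⟩
  · have hlim : Tendsto (fun n => q ^ n * N 0 / v 0) atTop (𝓝 (0 * N 0 / v 0)) :=
      ((tendsto_pow_atTop_nhds_zero_of_lt_one hq0.le hq).mul_const _).div_const _
    rw [zero_mul, zero_div] at hlim
    refine squeeze_zero (fun n => div_nonneg (hN_nonneg n) (hφ_pos n).le) (fun n => ?_) hlim
    have := hz0 n
    have := hN_nonneg 0
    gcongr
    exacts [hN_le n, hφ_ge n]
  · induction n with
    | zero =>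
      have : φ 0 = 1 := by simpa [hφ] using hsum
      simp [hm, this]
    | succ n ih =>
      have h1 : 0 < 1 - a * q ^ n := by nlinarith [hz1 n, hz0 n]
      have h2 : φ (n + 1) = (1 - a * q ^ n) * φ n := by linarith [hφ_rec n]
      have h3 : N (n + 1) = (1 - a * q ^ n) * N n - a * q ^ n * φ n := by linarith [hN_rec n]
      have h4 := hφ_pos n
      rw [ih, Finset.sum_range_succ]
      simp only
      rw [h2, h3, add_assoc, add_right_inj]
      field_simp
      ring

/-- With nodes `a * q ^ n`, the increments of `-log (1 - x)` are compared with rectangles using `log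
x ≤ x - 1`. The upper and lower rectangle sums used are the same series up to a shift by one, so the
gap is the single term `i = 0`. -/
theorem mean_bounds (hq0 : 0 < q) (hq : q < 1) (ha0 : 0 < a) (ha : a < 1) (h0 : 0 < v 0)
    (hv : ∀ k, v (k + 1) * (1 - q ^ (k + 1)) = a * v k) (hsum : ∑' k, v k = 1) :
    -Real.log (1 - a) ≤ (1 - q) * ∑' k : ℕ, k * v k ∧
      (1 - q) * ∑' k : ℕ, k * v k ≤ -Real.log (1 - a) + (1 - q) * (a / (1 - a)) := by
  obtain ⟨ψ, hψ, hψ0, hm⟩ := mean_eq_sum_add hq0 hq ha0 ha h0 hv hsum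
  have hpos : ∀ n : ℕ, 0 < 1 - a * q ^ n := fun n => by
    nlinarith [pow_le_one₀ (n := n) hq0.le hq.le, pow_pos hq0 n]
  have hz : ∀ n : ℕ, 0 < a * q ^ n := fun n => mul_pos ha0 (pow_pos hq0 n)
  set l : ℕ → ℝ := fun n => -Real.log (1 - a * q ^ n) with hl
  have hl0 : l 0 = -Real.log (1 - a) := by simp [hl]
  have hlnn : ∀ n, 0 ≤ l n := fun n =>
    neg_nonneg.2 (Real.log_nonpos (hpos n).le (by linarith [hz n]))
  have hllim : Tendsto l atTop (𝓝 0) := by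
    have h1 : Tendsto (fun n : ℕ => 1 - a * q ^ n) atTop (𝓝 (1 - a * 0)) :=
      tendsto_const_nhds.sub ((tendsto_pow_atTop_nhds_zero_of_lt_one hq0.le hq).const_mul a)
    have h2 := (h1.log (by norm_num)).neg
    simpa using h2
  have hup : ∀ n, l n - l (n + 1) ≤ (1 - q) * (a * q ^ n / (1 - a * q ^ n)) := by
    intro n
    have h := Real.log_le_sub_one_of_pos (div_pos (hpos (n + 1)) (hpos n))
    rw [Real.log_div (hpos _).ne' (hpos _).ne'] at h
    have h2 : (1 - a * q ^ (n + 1)) / (1 - a * q ^ n) - 1 =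
        (1 - q) * (a * q ^ n / (1 - a * q ^ n)) := by
      have := (hpos n).ne'
      field_simp
      ring
    simp only [hl]
    linarith
  have hlow : ∀ n, (1 - q) * (a * q ^ (n + 1) / (1 - a * q ^ (n + 1))) ≤ l n - l (n + 1) := by
    intro n
    have h := Real.log_le_sub_one_of_pos (div_pos (hpos n) (hpos (n + 1)))
    rw [Real.log_div (hpos _).ne' (hpos _).ne'] at h
    have h2 : (1 - a * q ^ n) / (1 - a * q ^ (n + 1)) - 1 =
        -((1 - q) * (a * q ^ n / (1 - a * q ^ (n + 1)))) := by
      have := (hpos (n + 1)).ne'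
      field_simp
      ring
    -- Shrinking the rectangle's width makes this the next term of the series, at the right sign for
    -- the bound.
    have h3 : (1 - q) * (a * q ^ (n + 1) / (1 - a * q ^ (n + 1))) ≤
        (1 - q) * (a * q ^ n / (1 - a * q ^ (n + 1))) := by
      have h4 := hpos (n + 1)
      have h5 : 0 ≤ 1 - q := by linarith
      have h6 : q ^ (n + 1) ≤ q ^ n := pow_le_pow_of_le_one hq0.le hq.le n.le_succ
      exact mul_le_mul_of_nonneg_left
        (div_le_div_of_nonneg_right (mul_le_mul_of_nonneg_left h6 ha0.le) h4.le) h5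
    simp only [hl]
    linarith
  constructor
  · have h1 : ∀ n, l 0 - l n ≤ (1 - q) * ∑' k : ℕ, k * v k := by
      intro n
      rw [hm n, mul_add, Finset.mul_sum, ← Finset.sum_range_sub']
      have := Finset.sum_le_sum fun i (_ : i ∈ Finset.range n) => hup i
      nlinarith [hψ0 n]
    have h2 := le_of_tendsto' (tendsto_const_nhds.sub hllim) h1
    rwa [sub_zero, hl0] at h2
  · have h1 : ∀ n, (1 - q) * ∑' k : ℕ, k * v k ≤
        l 0 + (1 - q) * (a / (1 - a)) + (1 - q) * ψ (n + 1) := by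
      intro n
      rw [hm (n + 1), mul_add, Finset.sum_range_succ', mul_add, Finset.mul_sum]
      have := Finset.sum_le_sum fun i (_ : i ∈ Finset.range n) => hlow i
      rw [Finset.sum_range_sub'] at this
      have := hlnn n
      simp only [pow_zero, mul_one]
      linarith
    have h2 := ge_of_tendsto' (tendsto_const_nhds.add
      ((hψ.comp (tendsto_add_atTop_nat 1)).const_mul (1 - q))) h1
    rwa [mul_zero, add_zero, hl0] at h2

end Mean

/-! ### Bounds for `wH` and the limit -/

namespace Market

variable {M : Market}

namespace IsRegular

theorem steadyState_spec (hM : M.IsRegular) : M.IsSteadyState M.steadyState := by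
  have h := hM.existsUnique_steadyState.exists
  rw [steadyState, dif_pos h]
  exact h.choose_spec

/-- The average waiting time is finite, and `lamH * wH` is the mean number of waiting `H` agents,
which is estimated by means of the steady-state recursion. -/
theorem wH_bounds (hM : M.IsRegular) : M.wH ≠ ⊤ ∧
    -Real.log (1 - M.joinProb.toReal) ≤ M.pH * (M.lamH * M.wH.toReal) ∧
    M.pH * (M.lamH * M.wH.toReal) ≤ -Real.log (1 - M.joinProb.toReal) +
      M.pH * (M.joinProb.toReal / (1 - M.joinProb.toReal)) := by
  have hπ := hM.steadyState_spec
  have hrec := hM.steady_recursion hπ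
  have hw := eq_mul_weight (f := fun k => M.steadyState (k, 0)) hM.q_lt_one hrec
  have hsum : ∑' k : ℕ, M.steadyState (k, 0) = 1 := by
    have := hM.tsum_steady_eq hπ fun _ => 1
    simpa only [mul_one, PMF.tsum_coe] using this.symm
  have h0 : M.steadyState (0, 0) ≠ 0 := by
    intro h
    simp only [h, zero_mul] at hw
    simp [hw] at hsum
  set v : ℕ → ℝ := fun k => (M.steadyState (k, 0)).toReal with hv
  have hof : ∀ k, M.steadyState (k, 0) = ENNReal.ofReal (v k) := fun k =>
    (ENNReal.ofReal_toReal (PMF.apply_ne_top _ _)).symm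
  have hv0 : 0 < v 0 := ENNReal.toReal_pos h0 (PMF.apply_ne_top _ _)
  have hq0 : 0 < 1 - (M.pH : ℝ) := by linarith [hM.pH_lt]
  have hq1 : 1 - (M.pH : ℝ) < 1 := by linarith [hM.pH_pos]
  have ha0 : 0 < M.joinProb.toReal := ENNReal.toReal_pos hM.joinProb_ne_zero hM.joinProb_lt_one.ne_top
  have ha1 : M.joinProb.toReal < 1 := by
    simpa using (ENNReal.toReal_lt_toReal hM.joinProb_lt_one.ne_top ENNReal.one_ne_top).2
      hM.joinProb_lt_one
  have hvrec : ∀ k, v (k + 1) * (1 - (1 - (M.pH : ℝ)) ^ (k + 1)) = M.joinProb.toReal * v k := by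
    intro k
    rw [← hM.q_toReal, ← toReal_one_sub_pow hM.q_lt_one, ← ENNReal.toReal_mul, hrec,
      ENNReal.toReal_mul]
  obtain ⟨hvpos, hvs⟩ := summable_of_recursion hq0.le hq1 ha0 ha1 hv0 hvrec
  have hvsum : ∑' k, v k = 1 := by
    rw [hv, ← ENNReal.tsum_toReal_eq fun k => PMF.apply_ne_top _ _, hsum, ENNReal.toReal_one]
  have hterm : ∀ k : ℕ, M.steadyState (k, 0) * k = ENNReal.ofReal (k * v k) := fun k => by
    rw [hof, mul_comm, ENNReal.ofReal_mul (Nat.cast_nonneg k), ENNReal.ofReal_natCast]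
  have hnn : ∀ k : ℕ, 0 ≤ k * v k := fun k => mul_nonneg (Nat.cast_nonneg k) (hvpos k).le
  have hms : Summable fun k : ℕ => k * v k :=
    hvs.of_nonneg_of_le hnn fun k => by nlinarith [hvpos k]
  have hmean : ∑' k : ℕ, M.steadyState (k, 0) * k = ENNReal.ofReal (∑' k : ℕ, k * v k) := by
    simp_rw [hterm]
    rw [ENNReal.ofReal_tsum_of_nonneg hnn hms]
  have hlittle := hM.lamH_mul_meanWaitH hπ
    (fun k => by rw [hof]; simpa using hvpos k) (hmean ▸ ENNReal.ofReal_ne_top)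
  rw [hmean] at hlittle
  have hreal : M.lamH * M.wH.toReal = ∑' k : ℕ, k * v k := by
    have := congrArg ENNReal.toReal hlittle
    rwa [ENNReal.toReal_mul, ENNReal.toReal_ofReal hM.lamH_pos.le,
      ENNReal.toReal_ofReal (tsum_nonneg hnn)] at this
  have hb := mean_bounds hq0 hq1 ha0 ha1 hv0 hvrec hvsum
  rw [sub_sub_cancel, ← hreal] at hb
  -- Finiteness is a separate claim because `toReal` sends `⊤` to `0`; an infinite `wH` would make
  -- the finite mean infinite.
  refine ⟨fun htop => ?_, hb⟩
  rw [← wH, htop, ENNReal.mul_top (by simpa using hM.lamH_pos)] at hlittle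
  exact ENNReal.ofReal_ne_top hlittle.symm

end IsRegular

theorem isRegular_mk {lamH lamE : ℝ} {d : ℕ} {pH : unitInterval} (hH : 0 < lamH) (hE : 0 < lamE)
    (hd : 1 ≤ d) (h0 : 0 < pH) (h1 : pH < 1) : (Market.mk lamH lamE pH 1 d).IsRegular :=
  ⟨hH, hE, hd, rfl, h0, h1⟩

theorem tendsto_mul_wH {lamH lamE : ℝ} {d : ℕ} (hH : 0 < lamH) (hE : 0 < lamE) (hd : 1 ≤ d) :
    Tendsto (fun pH : unitInterval => (pH : ℝ) * (Market.mk lamH lamE pH 1 d).wH.toReal)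
      (𝓝[>] (0 : unitInterval)) (𝓝 (Real.log (lamH / lamE + 1) / lamH)) := by
  set a : unitInterval → ℝ := fun pH => lamH / (lamH + lamE) * (1 - (pH : ℝ)) ^ d with ha
  have hp : Tendsto (fun pH : unitInterval => (pH : ℝ)) (𝓝[>] (0 : unitInterval)) (𝓝 0) :=
    (continuous_subtype_val.tendsto (0 : unitInterval)).mono_left nhdsWithin_le_nhds
  have halim : Tendsto a (𝓝[>] (0 : unitInterval)) (𝓝 (lamH / (lamH + lamE))) := by
    simpa using (((tendsto_const_nhds (x := (1 : ℝ))).sub hp).pow d).const_mul (lamH / (lamH + lamE))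
  have h1a : 1 - lamH / (lamH + lamE) = (lamH / lamE + 1)⁻¹ := by
    field_simp
    ring
  have hne : 1 - lamH / (lamH + lamE) ≠ 0 := by
    rw [h1a]
    positivity
  have hlog : Tendsto (fun pH => -Real.log (1 - a pH)) (𝓝[>] (0 : unitInterval))
      (𝓝 (Real.log (lamH / lamE + 1))) := by
    have := ((tendsto_const_nhds (x := (1 : ℝ))).sub halim).log hne |>.neg
    rwa [h1a, Real.log_inv, neg_neg] at this
  have hup : Tendsto (fun pH : unitInterval => -Real.log (1 - a pH) + pH * (a pH / (1 - a pH)))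
      (𝓝[>] (0 : unitInterval)) (𝓝 (Real.log (lamH / lamE + 1))) := by
    have := hlog.add (hp.mul (halim.div (tendsto_const_nhds.sub halim) hne))
    simpa using this
  have hev : ∀ᶠ pH : unitInterval in 𝓝[>] (0 : unitInterval), 0 < pH ∧ pH < 1 := by
    filter_upwards [self_mem_nhdsWithin, nhdsWithin_le_nhds (Iio_mem_nhds zero_lt_one)] with x h1 h2
    exact ⟨h1, h2⟩
  have hmain : Tendsto (fun pH : unitInterval => (pH : ℝ) *
      (lamH * (Market.mk lamH lamE pH 1 d).wH.toReal)) (𝓝[>] (0 : unitInterval))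
      (𝓝 (Real.log (lamH / lamE + 1))) := by
    refine tendsto_of_tendsto_of_tendsto_of_le_of_le' hlog hup ?_ ?_
    · filter_upwards [hev] with pH h
      have hM := isRegular_mk hH hE hd h.1 h.2
      have := hM.wH_bounds.2.1
      rwa [hM.joinProb_toReal] at this
    · filter_upwards [hev] with pH h
      have hM := isRegular_mk hH hE hd h.1 h.2
      have := hM.wH_bounds.2.2
      rwa [hM.joinProb_toReal] at this
  refine (hmain.div_const lamH).congr fun pH => ?_
  field_simp

end Market

/-! ### Monotonicity of the limit -/

theorem strictAntiOn_limit_lamE {lamH : ℝ} (hH : 0 < lamH) :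
    StrictAntiOn (fun lamE => Real.log (lamH / lamE + 1) / lamH) (Set.Ioi 0) := by
  intro x (hx : 0 < x) y (hy : 0 < y) hxy
  have : lamH / y < lamH / x := by gcongr
  simp only
  gcongr

/-- By strict concavity of `log`, the slope of its chord from `1` to `lamH / lamE + 1` decreases in
`lamH`. The point `x / lamE + 1` is the convex combination of `y / lamE + 1` and `1` with weight `x
/ y`. -/
theorem strictAntiOn_limit_lamH {lamE : ℝ} (hE : 0 < lamE) :
    StrictAntiOn (fun lamH => Real.log (lamH / lamE + 1) / lamH) (Set.Ioi 0) := by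
  intro x (hx : 0 < x) y (hy : 0 < y) hxy
  have hy1 : 0 < y / lamE := by positivity
  have hxy1 : 0 < 1 - x / y := by rwa [sub_pos, div_lt_one hy]
  have hc := strictConcaveOn_log_Ioi.2 (Set.mem_Ioi.2 (add_pos hy1 one_pos))
    (Set.mem_Ioi.2 (one_pos (α := ℝ))) (by linarith) (div_pos hx hy) hxy1 (by ring)
  simp only [smul_eq_mul, Real.log_one, mul_zero, add_zero, mul_one] at hc
  have h2 : x / y * (y / lamE + 1) + (1 - x / y) = x / lamE + 1 := by
    field_simp
    ring
  rw [h2] at hc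
  simp only
  rw [div_lt_div_iff₀ hy hx]
  rw [div_mul_eq_mul_div, div_lt_iff₀ hy] at hc
  linarith

end ChainMatching
end

theorem mainTheorem4 :
    (∀ (lamH lamE : ℝ) (d : ℕ) (pH : unitInterval), 0 < lamH → 0 < lamE → 1 ≤ d →
      0 < pH → pH < 1 →
        (∃! π : PMF ChainMatching.State,
          (ChainMatching.Market.mk lamH lamE pH 1 d).IsSteadyState π) ∧
        (ChainMatching.Market.mk lamH lamE pH 1 d).wH ≠ ⊤) ∧
    ∃ L : ℝ → ℝ → ℝ,
      (∀ (lamH lamE : ℝ) (d : ℕ), 0 < lamH → 0 < lamE → 1 ≤ d →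
        Tendsto
          (fun pH : unitInterval =>
            (pH : ℝ) * (ChainMatching.Market.mk lamH lamE pH 1 d).wH.toReal)
          (𝓝[>] (0 : unitInterval)) (𝓝 (L lamH lamE))) ∧
      (∀ lamH lamE : ℝ, 0 < lamH → 0 < lamE →
        L lamH lamE = Real.log (lamH / lamE + 1) / lamH) ∧
      (∀ lamH : ℝ, 0 < lamH → StrictAntiOn (fun lamE => L lamH lamE) (Set.Ioi 0)) ∧
      (∀ lamE : ℝ, 0 < lamE → StrictAntiOn (fun lamH => L lamH lamE) (Set.Ioi 0)) := by
  refine ⟨fun lamH lamE d pH hH hE hd h0 h1 => ?_,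
    fun lamH lamE => Real.log (lamH / lamE + 1) / lamH,
    fun lamH lamE d hH hE hd => ChainMatching.Market.tendsto_mul_wH hH hE hd,
    fun _ _ _ _ => rfl, fun _ hH => ChainMatching.strictAntiOn_limit_lamE hH,
    fun _ hE => ChainMatching.strictAntiOn_limit_lamH hE⟩
  have hM := ChainMatching.Market.isRegular_mk hH hE hd h0 h1
  exact ⟨hM.existsUnique_steadyState, hM.wH_bounds.1⟩
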